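/- **Setting.** Numeric terms are built from variables, the constant $0$, the unary successor $s$ and the binary function symbols $+$ and $\cdot$. Formulas are quantifier-free: they are built from equations between numeric terms by $\neg,\wedge,\vee,\to$. A sequent $\Gamma\vdash\Delta$ is a pair of finite multisets of formulas. Both calculi below contain the propositional rules of Gentzen's $\mathbf{LK}$ (weakening, contraction, cut, and the left and right rules for $\neg,\wedge,\vee,\to$) and, for all formulas $A$ and all terms, the initial sequents $A\vdash A$; the equality axioms $\vdash t=t$; $\;t=u\vdash s(t)=s(u)$; $\;t_1=u_1,t_2=u_2\vdash t_1+t_2=u_1+u_2$; $\;t_1=u_1,t_2=u_2\vdash t_1\cdot t_2=u_1\cdot u_2$; $\;t_1=u_1,t_2=u_2,t_1=t_2\vdash u_1=u_2$; and the arithmetical axioms $s(t)=0\vdash$; $\;s(t)=s(u)\vdash t=u$; $\;\vdash 0+u=u$; $\;\vdash s(t)+u=s(t+u)$; $\;\vdash 0\cdot u=0$; $\;\vdash s(t)\cdot u=t\cdot u+u$. **The $\mathbf{PRA}$-calculus** is the quantifier-free part of the sequent calculus of Peano arithmetic. Its variables are the passive parameters $\boldsymbol\alpha,\boldsymbol\beta,\dots$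 (countably many), and besides the above it has the induction rule $$\frac{F(\boldsymbol\alpha),\Gamma\vdash\Delta,F(s(\boldsymbol\alpha))}{F(0),\Gamma\vdash\Delta,F(t)}$$ where $t$ is any term and $\boldsymbol\alpha$ does not occur in $F(0),\Gamma,\Delta$. **The calculus $mv\mathbf{LKIE}$.** There are three disjoint countably infinite sorts of variables: active, passive and internal parameters. Every sequent in a derivation contains at most one active parameter. Besides the above, the calculus has the rule $$\frac{S(t)}{S(t')}\ \mathcal E$$ where $t=t'$ is a consequence of the equational theory $s(x)+y=s(x+y)$, $0+y=y$, $s(x)\cdot y=x\cdot y+y$, $0\cdot y=0$, and the induction rule $$\frac{F(n,\mathbf m_1,\dots,\mathbf m_k),\Gamma\vdash\Delta,F(s(n),\mathbf m_1,\dots,\mathbf m_k)}{F(0,\mathbf a_1,\dots,\mathbf a_k),\Gamma\vdash\Delta,F(t,\mathbf a_1,\dots,\mathbf a_k)}\ mv\mathbf{IND}$$ where $n$ is an active parameter, $\mathbf m_1,\dots,\mathbf m_k$ are internal parameters, $t,\mathbf a_1,\dots,\mathbf a_k$ are arbitrary terms (in which parameters of all sorts may occur), $n$ does not occur in $F(0,\mathbf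 m_1,\dots,\mathbf m_k),\Gamma,\Delta$, and an $\mathbf m_i$ that occurs in $\Gamma,\Delta$ is not instantiated, i.e. $\mathbf a_i=\mathbf m_i$ for it. An $mv\mathbf{LKIE}$-derivation is a *proof* if its end-sequent contains only passive parameters; it is *strict* if every passive parameter occurring in it occurs in its end-sequent; it is *$\mathcal E$-free* if it does not use the rule $\mathcal E$. **Theorem.** For every sequent $S$ there is an $\mathcal E$-free strict $mv\mathbf{LKIE}$-proof of $S$ if and only if there is a $\mathbf{PRA}$-calculus proof of $S$ (in particular, $S$ then contains only passive parameters). -/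

import Mathlib

namespace MvLKIE

/-! ## Language: `0`, `s`, `+`, `*`, `=`, and the propositional connectives -/

/-- The three kinds of numeric parameters, countably many of each. -/
inductive Param : Type
  | active (i : ℕ)
  | passive (i : ℕ)
  | internal (i : ℕ)

/-- Numeric terms over the variables `V`; `add` and `mul` are the two defined function symbols
(addition and multiplication). -/
inductive Tm (V : Type) : Type
  | var (x : V)
  | zero
  | succ (t : Tm V)
  | add (t u : Tm V)
  | mul (t u : Tm V)

/-- Quantifier-free formulas over the variables `V`; equality is the only predicate symbol. -/
inductive Fm (V : Type) : Type
  | eq (t u : Tm V)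
  | neg (A : Fm V)
  | and (A B : Fm V)
  | or (A B : Fm V)
  | imp (A B : Fm V)

/-- Sequents: pairs of finite multisets of formulas. -/
structure Sequent (V : Type) : Type where
  ant : Multiset (Fm V)
  suc : Multiset (Fm V)

/-! ### Simultaneous substitution and occurrence of variables -/

def Tm.subst {V W : Type} (θ : V → Tm W) : Tm V → Tm W
  | .var x => θ x
  | .zero => .zero
  | .succ t => .succ (t.subst θ)
  | .add t u => .add (t.subst θ) (u.subst θ)
  | .mul t u => .mul (t.subst θ) (u.subst θ)

def Fm.subst {V W : Type} (θ : V → Tm W) : Fm V → Fm W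
  | .eq t u => .eq (t.subst θ) (u.subst θ)
  | .neg A => .neg (A.subst θ)
  | .and A B => .and (A.subst θ) (B.subst θ)
  | .or A B => .or (A.subst θ) (B.subst θ)
  | .imp A B => .imp (A.subst θ) (B.subst θ)

def Sequent.subst {V W : Type} (θ : V → Tm W) (S : Sequent V) : Sequent W :=
  ⟨S.ant.map (Fm.subst θ), S.suc.map (Fm.subst θ)⟩

def Tm.Occurs {V : Type} (x : V) : Tm V → Prop
  | .var y => x = y
  | .zero => False
  | .succ t => t.Occurs x
  | .add t u => t.Occurs x ∨ u.Occurs x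
  | .mul t u => t.Occurs x ∨ u.Occurs x

def Fm.Occurs {V : Type} (x : V) : Fm V → Prop
  | .eq t u => t.Occurs x ∨ u.Occurs x
  | .neg A => A.Occurs x
  | .and A B => A.Occurs x ∨ B.Occurs x
  | .or A B => A.Occurs x ∨ B.Occurs x
  | .imp A B => A.Occurs x ∨ B.Occurs x

def Sequent.Occurs {V : Type} (x : V) (S : Sequent V) : Prop :=
  (∃ A ∈ S.ant, A.Occurs x) ∨ (∃ A ∈ S.suc, A.Occurs x)

/-! ## The rules common to both calculi: propositional LK with equality and the axioms of PA -/

/-- Initial sequents: the logical ones `A ⊢ A`, the equality axioms, and the (mathematical) axioms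
for successor, addition and multiplication, all for arbitrary terms. -/
inductive Initial {V : Type} : Sequent V → Prop
  | logical (A : Fm V) : Initial ⟨{A}, {A}⟩
  | eqRefl (t : Tm V) : Initial ⟨0, {.eq t t}⟩
  | eqSucc (t u : Tm V) : Initial ⟨{.eq t u}, {.eq (.succ t) (.succ u)}⟩
  | eqAdd (t₁ t₂ u₁ u₂ : Tm V) :
      Initial ⟨{.eq t₁ u₁, .eq t₂ u₂}, {.eq (.add t₁ t₂) (.add u₁ u₂)}⟩
  | eqMul (t₁ t₂ u₁ u₂ : Tm V) :
      Initial ⟨{.eq t₁ u₁, .eq t₂ u₂}, {.eq (.mul t₁ t₂) (.mul u₁ u₂)}⟩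
  | eqEq (t₁ t₂ u₁ u₂ : Tm V) :
      Initial ⟨{.eq t₁ u₁, .eq t₂ u₂, .eq t₁ t₂}, {.eq u₁ u₂}⟩
  | succNeZero (t : Tm V) : Initial ⟨{.eq (.succ t) .zero}, 0⟩
  | succInj (t u : Tm V) : Initial ⟨{.eq (.succ t) (.succ u)}, {.eq t u}⟩
  | zeroAdd (u : Tm V) : Initial ⟨0, {.eq (.add .zero u) u}⟩
  | succAdd (t u : Tm V) : Initial ⟨0, {.eq (.add (.succ t) u) (.succ (.add t u))}⟩
  | zeroMul (u : Tm V) : Initial ⟨0, {.eq (.mul .zero u) .zero}⟩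
  | succMul (t u : Tm V) : Initial ⟨0, {.eq (.mul (.succ t) u) (.add (.mul t u) u)}⟩

/-- The rules of propositional LK with one premise: `Unary P S` means that `S` follows from `P`. -/
inductive Unary {V : Type} : Sequent V → Sequent V → Prop
  | weakL (A : Fm V) (Γ Δ : Multiset (Fm V)) : Unary ⟨Γ, Δ⟩ ⟨A ::ₘ Γ, Δ⟩
  | weakR (A : Fm V) (Γ Δ : Multiset (Fm V)) : Unary ⟨Γ, Δ⟩ ⟨Γ, A ::ₘ Δ⟩
  | contrL (A : Fm V) (Γ Δ : Multiset (Fm V)) : Unary ⟨A ::ₘ A ::ₘ Γ, Δ⟩ ⟨A ::ₘ Γ, Δ⟩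
  | contrR (A : Fm V) (Γ Δ : Multiset (Fm V)) : Unary ⟨Γ, A ::ₘ A ::ₘ Δ⟩ ⟨Γ, A ::ₘ Δ⟩
  | negL (A : Fm V) (Γ Δ : Multiset (Fm V)) : Unary ⟨Γ, A ::ₘ Δ⟩ ⟨.neg A ::ₘ Γ, Δ⟩
  | negR (A : Fm V) (Γ Δ : Multiset (Fm V)) : Unary ⟨A ::ₘ Γ, Δ⟩ ⟨Γ, .neg A ::ₘ Δ⟩
  | andL₁ (A B : Fm V) (Γ Δ : Multiset (Fm V)) : Unary ⟨A ::ₘ Γ, Δ⟩ ⟨.and A B ::ₘ Γ, Δ⟩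
  | andL₂ (A B : Fm V) (Γ Δ : Multiset (Fm V)) : Unary ⟨B ::ₘ Γ, Δ⟩ ⟨.and A B ::ₘ Γ, Δ⟩
  | orR₁ (A B : Fm V) (Γ Δ : Multiset (Fm V)) : Unary ⟨Γ, A ::ₘ Δ⟩ ⟨Γ, .or A B ::ₘ Δ⟩
  | orR₂ (A B : Fm V) (Γ Δ : Multiset (Fm V)) : Unary ⟨Γ, B ::ₘ Δ⟩ ⟨Γ, .or A B ::ₘ Δ⟩
  | impR (A B : Fm V) (Γ Δ : Multiset (Fm V)) :
      Unary ⟨A ::ₘ Γ, B ::ₘ Δ⟩ ⟨Γ, .imp A B ::ₘ Δ⟩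

/-- The rules of propositional LK with two premises: `Binary P Q S` means that `S` follows from
`P` and `Q`. -/
inductive Binary {V : Type} : Sequent V → Sequent V → Sequent V → Prop
  | cut (A : Fm V) (Γ Δ Γ₁ Δ₁ : Multiset (Fm V)) :
      Binary ⟨Γ, A ::ₘ Δ⟩ ⟨A ::ₘ Γ₁, Δ₁⟩ ⟨Γ + Γ₁, Δ + Δ₁⟩
  | andR (A B : Fm V) (Γ Δ : Multiset (Fm V)) :
      Binary ⟨Γ, A ::ₘ Δ⟩ ⟨Γ, B ::ₘ Δ⟩ ⟨Γ, .and A B ::ₘ Δ⟩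
  | orL (A B : Fm V) (Γ Δ : Multiset (Fm V)) :
      Binary ⟨A ::ₘ Γ, Δ⟩ ⟨B ::ₘ Γ, Δ⟩ ⟨.or A B ::ₘ Γ, Δ⟩
  | impL (A B : Fm V) (Γ Δ Γ₁ Δ₁ : Multiset (Fm V)) :
      Binary ⟨Γ, A ::ₘ Δ⟩ ⟨B ::ₘ Γ₁, Δ₁⟩ ⟨.imp A B ::ₘ (Γ + Γ₁), Δ + Δ₁⟩

/-! ## The PRA-calculus: the quantifier-free part of the PA-calculus

Its variables are indexed by `ℕ`; variable number `i` is the passive parameter number `i`. -/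

/-- The substitution replacing the variable `a` by `t` and nothing else. -/
def single (a : ℕ) (t : Tm ℕ) : ℕ → Tm ℕ :=
  fun x => if x = a then t else .var x

/-- The induction rule of arithmetic, with eigenvariable `a`:
from `F(a), Γ ⊢ Δ, F(s(a))` infer `F(0), Γ ⊢ Δ, F(t)`. -/
inductive Ind : Sequent ℕ → Sequent ℕ → Prop
  | mk (F : Fm ℕ) (Γ Δ : Multiset (Fm ℕ)) (a : ℕ) (t : Tm ℕ)
      (ha : ¬ (Sequent.mk Γ Δ).Occurs a) :
      Ind ⟨F ::ₘ Γ, F.subst (single a (.succ (.var a))) ::ₘ Δ⟩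
        ⟨F.subst (single a .zero) ::ₘ Γ, F.subst (single a t) ::ₘ Δ⟩

/-- Proofs of the PRA-calculus with a given end-sequent. -/
inductive PRAProof : Sequent ℕ → Type
  | init {S : Sequent ℕ} (h : Initial S) : PRAProof S
  | unary {P S : Sequent ℕ} (h : Unary P S) (d : PRAProof P) : PRAProof S
  | binary {P Q S : Sequent ℕ} (h : Binary P Q S) (d : PRAProof P) (e : PRAProof Q) : PRAProof S
  | ind {P S : Sequent ℕ} (h : Ind P S) (d : PRAProof P) : PRAProof S

/-! ## The calculus mvLKIE -/

/-- Value of a term in an algebra with operations `z, s, a, m` for `0`, successor, `+`, `*`. -/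
def Tm.eval {V M : Type} (z : M) (s : M → M) (a m : M → M → M) (v : V → M) : Tm V → M
  | .var x => v x
  | .zero => z
  | .succ t => s (t.eval z s a m v)
  | .add t u => a (t.eval z s a m v) (u.eval z s a m v)
  | .mul t u => m (t.eval z s a m v) (u.eval z s a m v)

/-- `t = u` is a consequence of the equational theory given by `s(x) + y = s(x + y)`, `0 + y = y`,
`s(x) * y = x * y + y`, `0 * y = 0`. -/
def EqConsequence {V : Type} (t u : Tm V) : Prop :=
  ∀ (M : Type) (z : M) (s : M → M) (a m : M → M → M),
    (∀ x y, a (s x) y = s (a x y)) → (∀ y, a z y = y) →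
    (∀ x y, m (s x) y = a (m x y) y) → (∀ y, m z y = z) →
    ∀ v : V → M, t.eval z s a m v = u.eval z s a m v

/-- Fill the hole `none` by the term `t`. -/
def fill {V : Type} (t : Tm V) : Option V → Tm V
  | none => t
  | some x => .var x

/-- The rule `𝓔`: from `S(t)` infer `S(u)`, where `t = u` follows from the equational theory. -/
inductive ERule : Sequent Param → Sequent Param → Prop
  | mk (C : Sequent (Option Param)) (t u : Tm Param) (h : EqConsequence t u) :
      ERule (C.subst (fill t)) (C.subst (fill u))

/-- The substitution replacing the active parameter `n` by `t` and, simultaneously, every internal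
parameter `m` by `σ m`. -/
def inst (n : ℕ) (t : Tm Param) (σ : ℕ → Tm Param) : Param → Tm Param
  | .active k => if k = n then t else .var (.active k)
  | .internal m => σ m
  | .passive p => .var (.passive p)

/-- The rule `mvIND`: from `F(n, 𝐦), Γ ⊢ Δ, F(s(n), 𝐦)` infer `F(0, 𝐚), Γ ⊢ Δ, F(t, 𝐚)`.
The context is left unchanged, so the active parameter `n` does not occur in it, and an internal
parameter that occurs in it is not instantiated. -/
inductive MvInd : Sequent Param → Sequent Param → Prop
  | mk (F : Fm Param) (Γ Δ : Multiset (Fm Param)) (n : ℕ) (t : Tm Param) (σ : ℕ → Tm Param)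
      (hn : ¬ (Sequent.mk Γ Δ).Occurs (.active n))
      (hσ : ∀ m : ℕ, (Sequent.mk Γ Δ).Occurs (.internal m) → σ m = .var (.internal m)) :
      MvInd
        ⟨F ::ₘ Γ,
          F.subst (inst n (.succ (.var (.active n))) (fun m => .var (.internal m))) ::ₘ Δ⟩
        ⟨F.subst (inst n .zero σ) ::ₘ Γ, F.subst (inst n t σ) ::ₘ Δ⟩

/-- Schematic sequents contain at most one active parameter. -/
def AtMostOneActive (S : Sequent Param) : Prop :=
  ∀ i j : ℕ, S.Occurs (.active i) → S.Occurs (.active j) → i = j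

/-- mvLKIE-derivations with a given end-sequent. -/
inductive Derivation : Sequent Param → Type
  | init {S : Sequent Param} (hS : AtMostOneActive S) (h : Initial S) : Derivation S
  | unary {P S : Sequent Param} (hS : AtMostOneActive S) (h : Unary P S)
      (d : Derivation P) : Derivation S
  | binary {P Q S : Sequent Param} (hS : AtMostOneActive S) (h : Binary P Q S)
      (d : Derivation P) (e : Derivation Q) : Derivation S
  | eqn {P S : Sequent Param} (hS : AtMostOneActive S) (h : ERule P S)
      (d : Derivation P) : Derivation S
  | mvInd {P S : Sequent Param} (hS : AtMostOneActive S) (h : MvInd P S)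
      (d : Derivation P) : Derivation S

namespace Derivation

/-- The parameter `x` occurs in some sequent of the derivation. -/
def Uses (x : Param) : {S : Sequent Param} → Derivation S → Prop
  | S, .init _ _ => S.Occurs x
  | S, .unary _ _ d => S.Occurs x ∨ d.Uses x
  | S, .binary _ _ d e => S.Occurs x ∨ d.Uses x ∨ e.Uses x
  | S, .eqn _ _ d => S.Occurs x ∨ d.Uses x
  | S, .mvInd _ _ d => S.Occurs x ∨ d.Uses x

/-- The derivation contains no `𝓔`-inference. -/
def EFree : {S : Sequent Param} → Derivation S → Prop
  | _, .init _ _ => True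
  | _, .unary _ _ d => d.EFree
  | _, .binary _ _ d e => d.EFree ∧ e.EFree
  | _, .eqn _ _ _ => False
  | _, .mvInd _ _ d => d.EFree

/-- A derivation is a proof if its end-sequent contains only passive parameters. -/
def IsProof {S : Sequent Param} (_d : Derivation S) : Prop :=
  ∀ x : Param, S.Occurs x → ∃ i : ℕ, x = .passive i

/-- A derivation is strict if all passive parameters used in it occur in its end-sequent. -/
def IsStrict {S : Sequent Param} (d : Derivation S) : Prop :=
  ∀ i : ℕ, d.Uses (.passive i) → S.Occurs (.passive i)

end Derivation

/-- Read a sequent of the PRA-calculus as a sequent with only passive parameters. -/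
def Sequent.toPassive (T : Sequent ℕ) : Sequent Param :=
  T.subst (fun i => .var (.passive i))

end MvLKIE

namespace MvLKIE

variable {V W U : Type}

/-! ### Substitution and occurrence -/

/-! From `mvLKIE` to `PRA`, the statement proved by induction holds for every substitution of
`PRA`-terms for parameters. The rules of LK and the initial sequents are closed under substitution.
For an `mvIND`-inference, the instantiation `σ` is absorbed into the substitution applied to the
premise and the active parameter is sent to a fresh variable; what remains is an ordinary induction
(`MvInd.exists_ind`).

Conversely, the variables of a `PRA`-proof are read as internal parameters. Only induction needs
care, since its eigenvariable must become active. The key is `Derivable.inst_internal`: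
instantiating internal parameters is a derived rule. A sequent with internal parameters only is
folded into one formula `A`, so that no context blocks instantiation. If `⊢ A` is derivable, then so
is `n = 0 ∨ A ⊢ s(n) = 0 ∨ A`; `mvIND` gives `0 = 0 ∨ Aσ ⊢ s(0) = 0 ∨ Aσ`, hence `Aσ`. This rule
activates the eigenvariable before each induction and, at the very end, turns the internal
parameters into the passive ones of the end-sequent, which makes the proof strict. -/

theorem Tm.subst_subst (θ : V → Tm W) (η : W → Tm U) (t : Tm V) :
    (t.subst θ).subst η = t.subst (fun x => (θ x).subst η) := by
  induction t <;> simp_all [Tm.subst]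

theorem Fm.subst_subst (θ : V → Tm W) (η : W → Tm U) (A : Fm V) :
    (A.subst θ).subst η = A.subst (fun x => (θ x).subst η) := by
  induction A <;> simp_all [Fm.subst, Tm.subst_subst]

theorem Sequent.subst_subst (θ : V → Tm W) (η : W → Tm U) (S : Sequent V) :
    (S.subst θ).subst η = S.subst (fun x => (θ x).subst η) := by
  simp [Sequent.subst, Fm.subst_subst]

theorem Tm.subst_congr {θ η : V → Tm W} {t : Tm V} (h : ∀ x, t.Occurs x → θ x = η x) :
    t.subst θ = t.subst η := by
  induction t <;> simp_all [Tm.subst, Tm.Occurs]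

theorem Fm.subst_congr {θ η : V → Tm W} {A : Fm V} (h : ∀ x, A.Occurs x → θ x = η x) :
    A.subst θ = A.subst η := by
  induction A with
  | eq t u =>
    simp only [Fm.subst]
    rw [Tm.subst_congr fun x hx => h x (Or.inl hx), Tm.subst_congr fun x hx => h x (Or.inr hx)]
  | _ => simp_all [Fm.subst, Fm.Occurs]

theorem Sequent.subst_congr {θ η : V → Tm W} {S : Sequent V}
    (h : ∀ x, S.Occurs x → θ x = η x) : S.subst θ = S.subst η := by
  simp only [Sequent.subst, Sequent.mk.injEq]
  exact ⟨Multiset.map_congr rfl fun A hA =>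
      Fm.subst_congr fun x hx => h x (Or.inl ⟨A, hA, hx⟩),
    Multiset.map_congr rfl fun A hA =>
      Fm.subst_congr fun x hx => h x (Or.inr ⟨A, hA, hx⟩)⟩

theorem Tm.subst_var (t : Tm V) : t.subst .var = t := by
  induction t <;> simp_all [Tm.subst]

theorem Fm.subst_var (A : Fm V) : A.subst .var = A := by
  induction A <;> simp_all [Fm.subst, Tm.subst_var]

theorem Sequent.subst_var (S : Sequent V) : S.subst .var = S := by
  simp [Sequent.subst, Fm.subst_var]

theorem Tm.occurs_subst {θ : V → Tm W} {y : W} {t : Tm V} :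
    (t.subst θ).Occurs y ↔ ∃ x, t.Occurs x ∧ (θ x).Occurs y := by
  induction t <;> simp_all [Tm.subst, Tm.Occurs, or_and_right, exists_or]

theorem Fm.occurs_subst {θ : V → Tm W} {y : W} {A : Fm V} :
    (A.subst θ).Occurs y ↔ ∃ x, A.Occurs x ∧ (θ x).Occurs y := by
  induction A <;>
    simp_all [Fm.subst, Fm.Occurs, Tm.occurs_subst, or_and_right, exists_or]

theorem Sequent.occurs_subst {θ : V → Tm W} {y : W} {S : Sequent V} :
    (S.subst θ).Occurs y ↔ ∃ x, S.Occurs x ∧ (θ x).Occurs y := by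
  simp only [Sequent.Occurs, Sequent.subst, Multiset.mem_map]
  constructor
  · rintro (⟨_, ⟨A, hA, rfl⟩, h⟩ | ⟨_, ⟨A, hA, rfl⟩, h⟩) <;>
      obtain ⟨x, hx, hy⟩ := Fm.occurs_subst.1 h
    · exact ⟨x, Or.inl ⟨A, hA, hx⟩, hy⟩
    · exact ⟨x, Or.inr ⟨A, hA, hx⟩, hy⟩
  · rintro ⟨x, ⟨A, hA, hx⟩ | ⟨A, hA, hx⟩, hy⟩
    · exact Or.inl ⟨_, ⟨A, hA, rfl⟩, Fm.occurs_subst.2 ⟨x, hx, hy⟩⟩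
    · exact Or.inr ⟨_, ⟨A, hA, rfl⟩, Fm.occurs_subst.2 ⟨x, hx, hy⟩⟩

theorem Tm.finite_occurs (t : Tm V) : {x | t.Occurs x}.Finite := by
  induction t <;> simp_all [Tm.Occurs, Set.ofPred_or]

theorem Fm.finite_occurs (A : Fm V) : {x | A.Occurs x}.Finite := by
  induction A <;> simp_all [Fm.Occurs, Set.ofPred_or, Tm.finite_occurs]

theorem Sequent.finite_occurs (S : Sequent V) : {x | S.Occurs x}.Finite := by
  have key (Γ : Multiset (Fm V)) : {x | ∃ A ∈ Γ, A.Occurs x}.Finite := by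
    induction Γ using Multiset.induction with
    | empty => simp
    | cons A Γ ih => simpa [or_and_right, exists_or, Set.ofPred_or, Fm.finite_occurs] using ih
  exact (key S.ant).union (key S.suc)

theorem Sequent.exists_not_occurs (S : Sequent ℕ) : ∃ b, ¬ S.Occurs b :=
  S.finite_occurs.exists_notMem

theorem Sequent.occurs_mk {Γ Δ : Multiset (Fm V)} {x : V} :
    (Sequent.mk Γ Δ).Occurs x ↔ (∃ A ∈ Γ, A.Occurs x) ∨ ∃ A ∈ Δ, A.Occurs x := Iff.rfl

/-! ### The rules of LK and the initial sequents are closed under substitution -/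

theorem Initial.subst {S : Sequent V} (h : Initial S) (θ : V → Tm W) : Initial (S.subst θ) := by
  cases h <;> simp only [Sequent.subst, Multiset.insert_eq_cons, Multiset.map_cons,
    Multiset.map_singleton, Multiset.map_zero, Fm.subst, Tm.subst]
  · exact .logical _
  · exact .eqRefl _
  · exact .eqSucc _ _
  · exact .eqAdd _ _ _ _
  · exact .eqMul _ _ _ _
  · exact .eqEq _ _ _ _
  · exact .succNeZero _
  · exact .succInj _ _
  · exact .zeroAdd _
  · exact .succAdd _ _
  · exact .zeroMul _
  · exact .succMul _ _

theorem Unary.subst {P S : Sequent V} (h : Unary P S) (θ : V → Tm W) :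
    Unary (P.subst θ) (S.subst θ) := by
  cases h <;> simp only [Sequent.subst, Multiset.map_cons, Fm.subst]
  · exact .weakL _ _ _
  · exact .weakR _ _ _
  · exact .contrL _ _ _
  · exact .contrR _ _ _
  · exact .negL _ _ _
  · exact .negR _ _ _
  · exact .andL₁ _ _ _ _
  · exact .andL₂ _ _ _ _
  · exact .orR₁ _ _ _ _
  · exact .orR₂ _ _ _ _
  · exact .impR _ _ _ _

theorem Binary.subst {P Q S : Sequent V} (h : Binary P Q S) (θ : V → Tm W) :
    Binary (P.subst θ) (Q.subst θ) (S.subst θ) := by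
  cases h <;> simp only [Sequent.subst, Multiset.map_cons, Multiset.map_add, Fm.subst]
  · exact .cut _ _ _ _ _
  · exact .andR _ _ _ _
  · exact .orL _ _ _ _
  · exact .impL _ _ _ _ _ _

/-! ### From mvLKIE to the PRA-calculus -/

/-- Substituting for the parameters in an `mvIND`-inference yields, after its eigenvariable has
been renamed to a fresh variable, an inference by the induction rule of arithmetic. -/
theorem MvInd.exists_ind {P S : Sequent Param} (h : MvInd P S) (θ : Param → Tm ℕ) :
    ∃ η : Param → Tm ℕ, Ind (P.subst η) (S.subst θ) := by
  obtain ⟨F, Γ, Δ, n, t, σ, hn, hσ⟩ := h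
  -- The constant `0` adds no variables, so freshness for `F(0, 𝐚)` means freshness for the images
  -- of all parameters of `F` other than `n`.
  obtain ⟨b, hb⟩ := Sequent.exists_not_occurs
    ((Sequent.mk (F.subst (inst n .zero σ) ::ₘ Γ) Δ).subst θ)
  let η : Param → Tm ℕ
    | .active k => if k = n then .var b else θ (.active k)
    | .internal m => (σ m).subst θ
    | .passive p => θ (.passive p)
  have hη : η (.active n) = .var b := by simp [η]
  have hη' (x : Param) (hx : x ≠ .active n) (u : Tm Param) :
      η x = (inst n u σ x).subst θ := by
    cases x with
    | active k =>
      have hk : k ≠ n := fun h => hx (h ▸ rfl)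
      simp [η, inst, hk, Tm.subst]
    | _ => rfl
  have hF (u : Tm Param) (v : Tm ℕ) (huv : v = u.subst θ) :
      (F.subst η).subst (single b v) = (F.subst (inst n u σ)).subst θ := by
    rw [Fm.subst_subst, Fm.subst_subst]
    refine Fm.subst_congr fun x hx => ?_
    by_cases hxn : x = .active n
    · subst hxn
      simp [hη, Tm.subst, single, inst, huv]
    · rw [← hη' x hxn u]
      conv_rhs => rw [← Tm.subst_var (η x)]
      refine Tm.subst_congr fun y hy => ?_
      have : y ≠ b := by
        rintro rfl
        refine hb (Or.inl ⟨_, Multiset.mem_map_of_mem _ (Multiset.mem_cons_self _ _), ?_⟩)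
        rw [Fm.subst_subst]
        exact Fm.occurs_subst.2 ⟨x, hx, by rwa [← hη' x hxn]⟩
      simp [single, this]
  -- Both side conditions of `mvIND` enter here: `η` differs from `θ` only at `n` and at
  -- instantiated internal parameters, and neither occurs in the context.
  have hctx : (Sequent.mk Γ Δ).subst η = (Sequent.mk Γ Δ).subst θ := by
    refine Sequent.subst_congr fun x hx => ?_
    have hxn : x ≠ .active n := fun h => hn (h ▸ hx)
    rw [hη' x hxn (.var (.active n))]
    cases x with
    | active k =>
      have hk : k ≠ n := fun h => hxn (h ▸ rfl)
      simp [inst, Tm.subst, hk]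
    | passive p => rfl
    | internal m => simp [inst, hσ m hx, Tm.subst]
  have hS : (F.subst (inst n (.succ (.var (.active n))) fun m => .var (.internal m))).subst η
      = (F.subst η).subst (single b (.succ (.var b))) := by
    rw [Fm.subst_subst, Fm.subst_subst]
    refine Fm.subst_congr fun x hx => ?_
    by_cases hxn : x = .active n
    · subst hxn
      simp [hη, Tm.subst, single, inst]
    · have h1 : inst n (.succ (.var (.active n))) (fun m => .var (.internal m)) x = .var x := by
        cases x with
        | active k =>
          have hk : k ≠ n := fun h => hxn (h ▸ rfl)
          simp [inst, hk]
        | _ => rfl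
      rw [h1, Tm.subst]
      conv_lhs => rw [← Tm.subst_var (η x)]
      refine Tm.subst_congr fun y hy => ?_
      have : y ≠ b := by
        rintro rfl
        refine hb (Or.inl ⟨_, Multiset.mem_map_of_mem _ (Multiset.mem_cons_self _ _), ?_⟩)
        rw [Fm.subst_subst]
        exact Fm.occurs_subst.2 ⟨x, hx, by rwa [← hη' x hxn]⟩
      simp [single, this]
  refine ⟨η, ?_⟩
  have hΓ : Γ.map (Fm.subst η) = Γ.map (Fm.subst θ) := congrArg Sequent.ant hctx
  have hΔ : Δ.map (Fm.subst η) = Δ.map (Fm.subst θ) := congrArg Sequent.suc hctx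
  simp only [Sequent.subst, Multiset.map_cons, hS, hΓ, hΔ]
  rw [← hF .zero .zero rfl, ← hF t _ rfl]
  refine .mk _ _ _ b _ fun hc => hb ?_
  rcases hc with ⟨A, hA, h⟩ | ⟨A, hA, h⟩
  · exact Or.inl ⟨A, by simpa [Sequent.subst] using Or.inr (by simpa using hA), h⟩
  · exact Or.inr ⟨A, hA, h⟩

/-- The substitution must be arbitrary, because an `mvIND`-inference requires a different one for
its premise. -/
theorem Derivation.nonempty_praProof {S : Sequent Param} (d : Derivation S) (hd : d.EFree)
    (θ : Param → Tm ℕ) : Nonempty (PRAProof (S.subst θ)) := by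
  induction d generalizing θ with
  | init _ h => exact ⟨.init (h.subst θ)⟩
  | unary _ h _ ih =>
    obtain ⟨p⟩ := ih hd θ
    exact ⟨.unary (h.subst θ) p⟩
  | binary _ h _ _ ih₁ ih₂ =>
    obtain ⟨p⟩ := ih₁ hd.1 θ
    obtain ⟨q⟩ := ih₂ hd.2 θ
    exact ⟨.binary (h.subst θ) p q⟩
  | eqn => exact hd.elim
  | mvInd _ h _ ih =>
    obtain ⟨η, hη⟩ := h.exists_ind θ
    obtain ⟨p⟩ := ih hd η
    exact ⟨.ind hη p⟩

/-! ### `𝓔`-free derivations with a restricted set of parameters -/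

/-- The parameters allowed in the translation of a PRA-proof: a single active one, the passive ones
in `X` and all internal ones. -/
def Allowed (X : Set ℕ) : Param → Prop
  | .active k => k = 0
  | .passive i => i ∈ X
  | .internal _ => True

def Tm.Good (X : Set ℕ) (t : Tm Param) : Prop := ∀ x, t.Occurs x → Allowed X x

def Fm.Good (X : Set ℕ) (A : Fm Param) : Prop := ∀ x, A.Occurs x → Allowed X x

def Sequent.Good (X : Set ℕ) (S : Sequent Param) : Prop := ∀ x, S.Occurs x → Allowed X x

/-- `S` has an `𝓔`-free derivation in which only allowed parameters occur. -/
def Derivable (X : Set ℕ) (S : Sequent Param) : Prop :=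
  ∃ d : Derivation S, d.EFree ∧ ∀ x, d.Uses x → Allowed X x

theorem Sequent.good_mk {X : Set ℕ} {Γ Δ : Multiset (Fm Param)} :
    (Sequent.mk Γ Δ).Good X ↔ (∀ A ∈ Γ, A.Good X) ∧ ∀ A ∈ Δ, A.Good X := by
  simp only [Sequent.Good, Sequent.occurs_mk, Fm.Good]
  grind

theorem Fm.good_neg {X : Set ℕ} {A : Fm Param} : (Fm.neg A).Good X ↔ A.Good X := Iff.rfl

theorem Fm.good_or {X : Set ℕ} {A B : Fm Param} :
    (Fm.or A B).Good X ↔ A.Good X ∧ B.Good X := by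
  simp only [Fm.Good, Fm.Occurs]
  grind

theorem Sequent.Good.atMostOneActive {X : Set ℕ} {S : Sequent Param} (h : S.Good X) :
    AtMostOneActive S :=
  fun i j hi hj => (h _ hi : i = 0).trans (h _ hj : j = 0).symm

/-! ### Derived rules and inversions with controlled parameters -/

namespace Derivable

variable {X : Set ℕ} {P P₁ P₂ S : Sequent Param} {Γ Δ : Multiset (Fm Param)} {A B : Fm Param}

theorem good (h : Derivable X S) : S.Good X := by
  obtain ⟨d, -, hd⟩ := h
  intro x hx
  refine hd x ?_
  cases d <;> simp [Derivation.Uses, hx]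

theorem init (h : Initial S) (hS : S.Good X) : Derivable X S :=
  ⟨.init hS.atMostOneActive h, trivial, hS⟩

theorem unary (h : Unary P S) (hP : Derivable X P) (hS : S.Good X) : Derivable X S := by
  obtain ⟨d, h₁, h₂⟩ := hP
  exact ⟨.unary hS.atMostOneActive h d, h₁, fun x hx => hx.elim (hS x) (h₂ x)⟩

theorem binary (h : Binary P₁ P₂ S) (hP₁ : Derivable X P₁) (hP₂ : Derivable X P₂)
    (hS : S.Good X) : Derivable X S := by
  obtain ⟨d, h₁, h₂⟩ := hP₁
  obtain ⟨e, h₃, h₄⟩ := hP₂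
  exact ⟨.binary hS.atMostOneActive h d e, ⟨h₁, h₃⟩,
    fun x hx => hx.elim (hS x) fun hx => hx.elim (h₂ x) (h₄ x)⟩

theorem mvInd (h : MvInd P S) (hP : Derivable X P) (hS : S.Good X) : Derivable X S := by
  obtain ⟨d, h₁, h₂⟩ := hP
  exact ⟨.mvInd hS.atMostOneActive h d, h₁, fun x hx => hx.elim (hS x) (h₂ x)⟩

theorem logical (hA : A.Good X) : Derivable X ⟨{A}, {A}⟩ :=
  init (.logical A) (by simpa [Sequent.good_mk] using hA)

theorem weakR (hA : A.Good X) (h : Derivable X ⟨Γ, Δ⟩) : Derivable X ⟨Γ, A ::ₘ Δ⟩ := by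
  refine unary (.weakR A Γ Δ) h ?_
  have := Sequent.good_mk.1 h.good
  simp_all [Sequent.good_mk]

theorem negR (h : Derivable X ⟨A ::ₘ Γ, Δ⟩) : Derivable X ⟨Γ, .neg A ::ₘ Δ⟩ := by
  refine unary (.negR A Γ Δ) h ?_
  have := Sequent.good_mk.1 h.good
  simp_all [Sequent.good_mk, Fm.good_neg]

/-- Inversion by a cut against `¬A, A ⊢`. -/
theorem of_negR (h : Derivable X ⟨Γ, .neg A ::ₘ Δ⟩) : Derivable X ⟨A ::ₘ Γ, Δ⟩ := by
  have hg := Sequent.good_mk.1 h.good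
  have hA : A.Good X := Fm.good_neg.1 (hg.2 _ (Multiset.mem_cons_self _ _))
  have h₁ : Derivable X ⟨.neg A ::ₘ {A}, 0⟩ :=
    unary (.negL A {A} 0) (logical hA) (by simp [Sequent.good_mk, Fm.good_neg, hA])
  have h₂ := binary (.cut (.neg A) Γ Δ {A} 0) h h₁ (by
    simp_all [Sequent.good_mk, or_imp, forall_and])
  simpa [add_comm Γ] using h₂

theorem orR (h : Derivable X ⟨Γ, A ::ₘ B ::ₘ Δ⟩) : Derivable X ⟨Γ, .or A B ::ₘ Δ⟩ := by
  have hg := Sequent.good_mk.1 h.good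
  have h₁ : Derivable X ⟨Γ, .or A B ::ₘ B ::ₘ Δ⟩ :=
    unary (.orR₁ A B _ _) h (by simp_all [Sequent.good_mk, Fm.good_or])
  rw [Multiset.cons_swap] at h₁
  have h₂ : Derivable X ⟨Γ, .or A B ::ₘ .or A B ::ₘ Δ⟩ :=
    unary (.orR₂ A B _ _) h₁ (by simp_all [Sequent.good_mk, Fm.good_or])
  exact unary (.contrR _ _ _) h₂ (by simp_all [Sequent.good_mk, Fm.good_or])

/-- Inversion by a cut against `A ∨ B ⊢ A, B`. -/
theorem of_orR (h : Derivable X ⟨Γ, .or A B ::ₘ Δ⟩) : Derivable X ⟨Γ, A ::ₘ B ::ₘ Δ⟩ := by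
  have hg := Sequent.good_mk.1 h.good
  obtain ⟨hA, hB⟩ := Fm.good_or.1 (hg.2 _ (Multiset.mem_cons_self _ _))
  have h₁ : Derivable X ⟨A ::ₘ 0, A ::ₘ B ::ₘ 0⟩ := by
    rw [Multiset.cons_swap]
    exact weakR hB (logical hA)
  have h₂ : Derivable X ⟨B ::ₘ 0, A ::ₘ B ::ₘ 0⟩ := weakR hA (logical hB)
  have h₃ : Derivable X ⟨.or A B ::ₘ 0, A ::ₘ B ::ₘ 0⟩ :=
    binary (.orL A B 0 _) h₁ h₂ (by simp [Sequent.good_mk, Fm.good_or, hA, hB])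
  have h₄ := binary (.cut (.or A B) Γ Δ 0 (A ::ₘ B ::ₘ 0)) h h₃ (by
    simp_all [Sequent.good_mk, or_imp, forall_and])
  have h₅ : Δ + A ::ₘ B ::ₘ 0 = A ::ₘ B ::ₘ Δ := by
    rw [Multiset.add_cons, Multiset.add_cons, add_zero]
  rwa [add_zero, h₅] at h₄

theorem of_succNeZero {t : Tm Param} (h : Derivable X ⟨Γ, .eq (.succ t) .zero ::ₘ Δ⟩) :
    Derivable X ⟨Γ, Δ⟩ := by
  have hg := Sequent.good_mk.1 h.good
  have h₁ : Derivable X ⟨.eq (.succ t) .zero ::ₘ 0, 0⟩ :=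
    init (.succNeZero t) (by simp_all [Sequent.good_mk])
  have h₂ := binary (.cut _ Γ Δ 0 0) h h₁ (by simp_all [Sequent.good_mk])
  simpa using h₂

/-! ### Instantiation of internal parameters is a derived rule -/

/-- The succedent is folded into a disjunction. Since substitution commutes with the connectives,
the inversion can be carried out after substituting, which is the form needed to transport an
instantiation from `B` back to the sequent. -/
theorem exists_formula_of_suc (A : Fm Param) (Δ : Multiset (Fm Param)) :
    ∃ B : Fm Param, (∀ x, B.Occurs x → (Sequent.mk 0 (A ::ₘ Δ)).Occurs x) ∧
      (Derivable X ⟨0, A ::ₘ Δ⟩ → Derivable X ⟨0, {B}⟩) ∧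
      ∀ θ : Param → Tm Param, Derivable X ⟨0, {B.subst θ}⟩ →
        Derivable X ((Sequent.mk 0 (A ::ₘ Δ)).subst θ) := by
  induction Δ using Multiset.induction generalizing A with
  | empty => exact ⟨A, by simp [Sequent.Occurs], id, fun θ h => by simpa [Sequent.subst] using h⟩
  | cons C Δ ih =>
    obtain ⟨B, h₁, h₂, h₃⟩ := ih (.or A C)
    refine ⟨B, fun x hx => ?_, fun h => h₂ h.orR, fun θ h => ?_⟩
    · simpa [Sequent.Occurs, Fm.Occurs, or_assoc] using h₁ x hx
    · have := h₃ θ h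
      simp only [Sequent.subst, Multiset.map_cons, Fm.subst] at this ⊢
      exact this.of_orR

theorem exists_formula (Γ Δ : Multiset (Fm Param)) :
    ∃ B : Fm Param, (∀ x, B.Occurs x → (Sequent.mk Γ Δ).Occurs x) ∧
      (Derivable X ⟨Γ, Δ⟩ → Derivable X ⟨0, {B}⟩) ∧
      ∀ θ : Param → Tm Param, Derivable X ⟨0, {B.subst θ}⟩ →
        Derivable X ((Sequent.mk Γ Δ).subst θ) := by
  induction Γ using Multiset.induction generalizing Δ with
  | empty =>
    -- The closed false equation `s(0) = 0` guards against an empty succedent; substitution fixes it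
    -- and a cut removes it.
    obtain ⟨B, h₁, h₂, h₃⟩ := exists_formula_of_suc (X := X) (.eq (.succ .zero) .zero) Δ
    refine ⟨B, fun x hx => ?_, fun h => h₂ (h.weakR ?_), fun θ h => ?_⟩
    · simpa [Sequent.Occurs, Fm.Occurs, Tm.Occurs] using h₁ x hx
    · simp [Fm.Good, Fm.Occurs, Tm.Occurs]
    · have := h₃ θ h
      simp only [Sequent.subst, Multiset.map_cons, Fm.subst, Tm.subst] at this ⊢
      exact this.of_succNeZero
  | cons C Γ ih =>
    obtain ⟨B, h₁, h₂, h₃⟩ := ih (.neg C ::ₘ Δ)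
    refine ⟨B, fun x hx => ?_, fun h => h₂ h.negR, fun θ h => ?_⟩
    · have := h₁ x hx
      simp only [Sequent.Occurs, Multiset.mem_cons, exists_eq_or_imp, Fm.Occurs] at this ⊢
      rwa [or_left_comm, ← or_assoc] at this
    · have := h₃ θ h
      simp only [Sequent.subst, Multiset.map_cons, Fm.subst] at this ⊢
      exact this.of_negR

/-- The value given to the active parameter is immaterial, as none occurs in `S`; `s(0)` is the term
at which the induction below concludes. -/
theorem inst_internal (h : Derivable X S)
    (hS : ∀ x, S.Occurs x → ∃ m, x = .internal m) (σ : ℕ → Tm Param)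
    (hσ : ∀ m, S.Occurs (.internal m) → (σ m).Good X) :
    Derivable X (S.subst (inst 0 (.succ .zero) σ)) := by
  obtain ⟨Γ, Δ⟩ := S
  obtain ⟨A, hA, hd, hinst⟩ := exists_formula (X := X) Γ Δ
  have hd := hd h
  have hAg : A.Good X := (Sequent.good_mk.1 hd.good).2 A (by simp)
  have hAσ (t : Tm Param) : (A.subst (inst 0 t σ)).Good X := by
    intro y hy
    obtain ⟨x, hx, hy⟩ := Fm.occurs_subst.1 hy
    obtain ⟨m, rfl⟩ := hS x (hA x hx)
    exact hσ m (hA _ hx) y hy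
  have hstep : A.subst (inst 0 (.succ (.var (.active 0))) fun m => .var (.internal m)) = A := by
    conv_rhs => rw [← Fm.subst_var A]
    refine Fm.subst_congr fun x hx => ?_
    obtain ⟨m, rfl⟩ := hS x (hA x hx)
    rfl
  have hn (t : Tm Param) (ht : t.Good X) : (Fm.eq t .zero).Good X := by
    intro x hx
    simp only [Fm.Occurs, Tm.Occurs, or_false] at hx
    exact ht x hx
  have hv : (Tm.var (.active 0) : Tm Param).Good X := by
    rintro x rfl
    rfl
  have hz : (Tm.zero : Tm Param).Good X := fun x hx => hx.elim
  -- The disjunct `n = 0` supplies an active parameter; it is provable at `0` and refutable at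
  -- `s(0)`.
  let F : Fm Param := .or (.eq (.var (.active 0)) .zero) A
  have hprem : Derivable X ⟨F ::ₘ 0,
      F.subst (inst 0 (.succ (.var (.active 0))) fun m => .var (.internal m)) ::ₘ 0⟩ := by
    simp only [F, Fm.subst, Tm.subst, inst, if_true, hstep]
    refine unary (.weakL _ _ _) (orR (weakR (hn (.succ _) hv) hd)) ?_
    simp [Sequent.good_mk, Fm.good_or, hn _ hv, hn (.succ (.var (.active 0))) hv, hAg]
  -- With an empty context the side conditions are vacuous, so `σ` is unrestricted.
  have hconc := mvInd (.mk F 0 0 0 (.succ .zero) σ (by simp [Sequent.Occurs])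
    (by simp [Sequent.Occurs])) hprem (by
      simp [F, Fm.subst, Tm.subst, inst, Sequent.good_mk, Fm.good_or, hAσ, hn _ hz,
        hn (.succ .zero) hz])
  have hbase : Derivable X ⟨0, F.subst (inst 0 .zero σ) ::ₘ 0⟩ := by
    simp only [F, Fm.subst, Tm.subst, inst, if_true]
    refine unary (.orR₁ _ _ _ _) (init (.eqRefl .zero) ?_) ?_ <;>
      simp [Sequent.good_mk, Fm.good_or, hAσ, hn _ hz]
  have hcut := binary (.cut _ 0 0 0 _) hbase hconc (by
    simp [F, Fm.subst, Tm.subst, inst, Sequent.good_mk, Fm.good_or, hAσ, hn (.succ .zero) hz])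
  simp only [F, Fm.subst, Tm.subst, inst, if_true, add_zero, zero_add] at hcut
  exact hinst _ hcut.of_orR.of_succNeZero

end Derivable

/-! ### From the PRA-calculus to mvLKIE -/

/-- Read a sequent of the PRA-calculus as a sequent with only internal parameters. -/
def Sequent.toInternal (T : Sequent ℕ) : Sequent Param :=
  T.subst (fun i => .var (.internal i))

theorem Sequent.occurs_toInternal {T : Sequent ℕ} {x : Param} (h : T.toInternal.Occurs x) :
    ∃ m, x = .internal m := by
  obtain ⟨m, -, rfl⟩ := Sequent.occurs_subst.1 h
  exact ⟨m, rfl⟩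

theorem Sequent.good_toInternal (X : Set ℕ) (T : Sequent ℕ) : T.toInternal.Good X := by
  intro x hx
  obtain ⟨m, rfl⟩ := Sequent.occurs_toInternal hx
  trivial

theorem Sequent.toInternal_subst_inst (T : Sequent ℕ) (n : ℕ) (t : Tm Param)
    (σ : ℕ → Tm Param) : T.toInternal.subst (inst n t σ) = T.subst σ :=
  Sequent.subst_subst _ _ _

theorem Derivable.ind {X : Set ℕ} {P S : Sequent ℕ} (h : Ind P S)
    (hP : Derivable X P.toInternal) : Derivable X S.toInternal := by
  obtain ⟨F, Γ, Δ, a, t, ha⟩ := h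
  -- Only the eigenvariable becomes active; every other variable remains internal.
  let σ : ℕ → Tm Param := fun i => if i = a then .var (.active 0) else .var (.internal i)
  have hctx : (Sequent.mk Γ Δ).subst σ = (Sequent.mk Γ Δ).toInternal := by
    refine Sequent.subst_congr fun x hx => ?_
    have hxa : x ≠ a := fun h => ha (h ▸ hx)
    simp [σ, hxa]
  have hΓ : Γ.map (Fm.subst σ) = Γ.map (Fm.subst fun i => .var (.internal i)) :=
    congrArg Sequent.ant hctx
  have hΔ : Δ.map (Fm.subst σ) = Δ.map (Fm.subst fun i => .var (.internal i)) :=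
    congrArg Sequent.suc hctx
  -- This is used with `τ = σ` for the succedent formula of the premise, and with `τ` the internal
  -- reading for the two formulas of the conclusion.
  have hF (u : Tm ℕ) (v : Tm Param) (τ : ℕ → Tm Param) (hv : v = u.subst τ)
      (hτ : ∀ i, i ≠ a → τ i = .var (.internal i)) :
      (F.subst σ).subst (inst 0 v fun m => .var (.internal m)) =
        (F.subst (single a u)).subst τ := by
    rw [Fm.subst_subst, Fm.subst_subst]
    refine Fm.subst_congr fun x _ => ?_
    by_cases hx : x = a
    · simp [σ, single, hx, Tm.subst, inst, hv]
    · simp [σ, single, hx, Tm.subst, inst, hτ x hx]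
  have hprem := hP.inst_internal (fun x => Sequent.occurs_toInternal) σ (by
    intro m _ x hx
    by_cases hm : m = a
    · simp only [σ, hm, if_true, Tm.Occurs] at hx
      subst hx
      rfl
    · simp only [σ, hm, if_false, Tm.Occurs] at hx
      subst hx
      trivial)
  rw [Sequent.toInternal_subst_inst] at hprem
  simp only [Sequent.subst, Multiset.map_cons, hΓ, hΔ] at hprem
  rw [← hF (.succ (.var a)) (.succ (.var (.active 0))) σ (by simp [Tm.subst, σ])
    (fun i hi => by simp [σ, hi])] at hprem
  have hgood := Sequent.good_toInternal X
    ⟨F.subst (single a .zero) ::ₘ Γ, F.subst (single a t) ::ₘ Δ⟩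
  simp only [Sequent.toInternal, Sequent.subst, Multiset.map_cons] at hgood ⊢
  rw [← hF .zero .zero _ rfl (fun _ _ => rfl), ← hF t _ _ rfl (fun _ _ => rfl)] at hgood ⊢
  refine .mvInd (.mk _ _ _ 0 _ _ (fun h => ?_) fun _ _ => rfl) hprem hgood
  obtain ⟨m, hm⟩ := Sequent.occurs_toInternal (T := ⟨Γ, Δ⟩) h
  cases hm

/-- `X` is arbitrary because the translation needs no passive parameters at all. -/
theorem PRAProof.derivable_toInternal (X : Set ℕ) {T : Sequent ℕ} (p : PRAProof T) :
    Derivable X T.toInternal := by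
  induction p with
  | init h => exact .init (h.subst _) (Sequent.good_toInternal X _)
  | unary h _ ih => exact .unary (h.subst _) ih (Sequent.good_toInternal X _)
  | binary h _ _ ih₁ ih₂ => exact .binary (h.subst _) ih₁ ih₂ (Sequent.good_toInternal X _)
  | ind h _ ih => exact .ind h ih

/-- Taking for `X` the variables of `T` is what yields strictness. -/
theorem PRAProof.derivable_toPassive {T : Sequent ℕ} (p : PRAProof T) :
    Derivable {i | T.Occurs i} T.toPassive := by
  have h := (p.derivable_toInternal {i | T.Occurs i}).inst_internal
    (fun x => Sequent.occurs_toInternal) (fun i => .var (.passive i)) (by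
      rintro m hm _ rfl
      obtain ⟨i, hi, hmi⟩ := Sequent.occurs_subst.1 hm
      cases hmi
      exact hi)
  rwa [Sequent.toInternal_subst_inst] at h

/-- The substitution that reads passive parameters as variables of the PRA-calculus. -/
def ofPassive : Param → Tm ℕ
  | .passive i => .var i
  | _ => .zero

theorem Sequent.toPassive_subst_ofPassive {S : Sequent Param}
    (h : ∀ x, S.Occurs x → ∃ i, x = .passive i) : (S.subst ofPassive).toPassive = S := by
  rw [Sequent.toPassive, Sequent.subst_subst]
  conv_rhs => rw [← Sequent.subst_var S]
  refine Sequent.subst_congr fun x hx => ?_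
  obtain ⟨i, rfl⟩ := h x hx
  rfl

end MvLKIE

theorem mainTheorem3 (S : MvLKIE.Sequent MvLKIE.Param) :
    (∃ d : MvLKIE.Derivation S, d.IsProof ∧ d.IsStrict ∧ d.EFree) ↔
      ∃ T : MvLKIE.Sequent ℕ, T.toPassive = S ∧ Nonempty (MvLKIE.PRAProof T) := by
  constructor
  · rintro ⟨d, hp, -, hE⟩
    -- The end-sequent of a proof has only passive parameters, so the default `0` of `ofPassive`
    -- does not affect it.
    exact ⟨S.subst MvLKIE.ofPassive, MvLKIE.Sequent.toPassive_subst_ofPassive hp,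
      d.nonempty_praProof hE _⟩
  · rintro ⟨T, rfl, ⟨p⟩⟩
    obtain ⟨d, hE, hd⟩ := p.derivable_toPassive
    refine ⟨d, fun x hx => ?_, fun i hi => ?_, hE⟩
    · obtain ⟨i, -, rfl⟩ := MvLKIE.Sequent.occurs_subst.1 hx
      exact ⟨i, rfl⟩
    · exact MvLKIE.Sequent.occurs_subst.2 ⟨i, hd _ hi, rfl⟩
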